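/- **Hypermaps.** A hypermap is a cell decomposition of a compact closed surface into disks of three types, vertices (type $0$), hyperedges (type $1$) and faces (type $2$), where disks of the same type are disjoint and disks of different types meet only along arcs of their boundaries. It is given by the finite set $X$ of its flags (points where three cells meet) and three fixed-point free involutions $\tau_0,\tau_1,\tau_2$ of $X$, where $\tau_c$ exchanges the ends of each arc of colour $c$, i.e. of each arc of intersection of cells of the two types different from $c$. The cells of type $t$ are the orbits of $\langle \tau_c : c\neq t\rangle$. The hypermap is oriented if $X$ is divided into positive and negative flags such that every arc joins a positive to a negative flag; equivalently, all boundary circles of cells are directed coherently, the circle of a cell of type $t$ running along arcs of colour $t+1$ (mod $3$) from the positive to the negative end and along arcs of colour $t+2$ (mod $3$) from the negative to the positive end. Its $\sigma$-model consists of the permutations $$\sigma_V=\tau_2\tau_1,\qquad \sigma_E=\tau_0\tau_2,\qquad \sigma_F=\tau_1\tau_0$$ (products are read from right to left) of the set $H$ of half-edges, i.e. of arcs of colour $2$, each labelled by its positive end. They satisfy $\sigma_F\sigma_E\sigma_V=1$, and the cycles (including those of length one) of $\sigma_V$, $\sigma_E$, $\sigma_F$ correspond to the vertices, hyperedges and faces.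 **Partial duality.** Let $S$ be a set of cells of type $i$, let $j\ne i$ be another type and $k$ the third one. The partial dual $\mathfrak{hm}^S$ is constructed as follows. (1) Let $F$ be the union of the cells in $S$ and all cells of type $j$. (2) Glue a disk to each component of $\partial F$; these disks are the cells of type $j$ of $\mathfrak{hm}^S$. (3) Take a copy of every cell of type $i$, attached to the new cells of type $j$ along the arcs of its boundary that lie on $\partial F$. (4) Glue a disk to each boundary component of the surface obtained in (3); these disks are the cells of type $k$. If $\mathfrak{hm}$ is oriented, then the boundary circles of the new cells of type $j$ are directed as $\partial F$, where $F$ is oriented as a part of the surface of $\mathfrak{hm}$, and this directs the other cells. The flags of $\mathfrak{hm}^S$ are the same points as those of $\mathfrak{hm}$. **Theorem.** Let $\mathfrak{hm}=(\sigma_V,\sigma_E,\sigma_F)$ be an oriented hypermap, and let $V'$, $E'$, $F'$ be a set of its vertices, of its hyperedges, and of its faces, respectively. For either choice of the auxiliary type $j$, the construction determines a unique oriented hypermap on the same flags, and, with the half-edges of the partial dual labelled by their positive ends as before, $$\begin{aligned} \mathfrak{hm}^{V'}&=(\sigma_{\overline{V'}}\sigma_{V'}^{-1},\ \sigma_E\sigma_{V'},\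 \sigma_{V'}\sigma_F),\\ \mathfrak{hm}^{E'}&=(\sigma_{E'}\sigma_V,\ \sigma_{\overline{E'}}\sigma_{E'}^{-1},\ \sigma_F\sigma_{E'}),\\ \mathfrak{hm}^{F'}&=(\sigma_V\sigma_{F'},\ \sigma_{F'}\sigma_E,\ \sigma_{\overline{F'}}\sigma_{F'}^{-1}). \end{aligned}$$ Here $\sigma_{V'}$ (resp. $\sigma_{E'}$, $\sigma_{F'}$) is the permutation consisting of the cycles of $\sigma_V$ (resp. $\sigma_E$, $\sigma_F$) that correspond to the elements of $V'$ (resp. $E'$, $F'$), and $\sigma_{\overline{V'}}$, $\sigma_{\overline{E'}}$, $\sigma_{\overline{F'}}$ are the permutations consisting of the remaining cycles. -/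

import Mathlib

/-!
Hypermaps as cell decompositions of closed surfaces into disks of three types. Types and colours
are both indexed by `Fin 3`: type `0` = vertices, `1` = hyperedges, `2` = faces, and an arc of
colour `c` is an arc of intersection of two cells of the two types different from `c`.
-/

/-- A hypermap on the set `X` of local flags (the points where three cells meet): three
fixed-point free involutions, `τ c` exchanging the two ends of every arc of colour `c`. -/
@[ext]
structure Hypermap (X : Type*) where
  τ : Fin 3 → Equiv.Perm X
  τ_invol : ∀ c x, τ c (τ c x) = x
  τ_ne : ∀ c x, τ c x ≠ x

namespace Hypermap

variable {X : Type*} (M : Hypermap X)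

/-- The cells of type `t`: the orbits of the group generated by the two involutions `τ c`,
`c ≠ t`. -/
def Cell (t : Fin 3) : Type _ :=
  MulAction.orbitRel.Quotient (Subgroup.closure {g : Equiv.Perm X | ∃ c, c ≠ t ∧ g = M.τ c}) X

/-- The cell of type `t` at the flag `x`. -/
def cell (t : Fin 3) (x : X) : M.Cell t :=
  Quotient.mk (MulAction.orbitRel
    (Subgroup.closure {g : Equiv.Perm X | ∃ c, c ≠ t ∧ g = M.τ c}) X) x

/-- The arcs of intersection of the cells. -/
structure Arc where
  colour : Fin 3
  ends : Sym2 X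
  isArc : ∃ x, ends = s(x, M.τ colour x)

/-- The boundary circle of a cell, as a set of arcs. -/
def circle (d : Σ t, M.Cell t) : Set M.Arc :=
  {a | a.colour ≠ d.1 ∧ ∃ x ∈ a.ends, M.cell d.1 x = d.2}

end Hypermap

/-- Disks with the boundary circles `circle d` are glued together along the arcs that they share.
The arcs forming the boundary of the resulting surface are those lying on exactly one disk. -/
def boundaryArcs {A D : Type*} (circle : D → Set A) : Set A :=
  {a | ∃! d, a ∈ circle d}

/-- The connected components of the union of a set `B` of arcs. -/
def Component {X A : Type*} (ends : A → Sym2 X) (B : Set A) : Type _ :=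
  Quot fun a b : B => ∃ x, x ∈ ends a ∧ x ∈ ends b

/-- The arcs in a connected component. -/
def Component.arcs {X A : Type*} {ends : A → Sym2 X} {B : Set A} (q : Component ends B) : Set A :=
  {a | ∃ h : a ∈ B, Quot.mk _ ⟨a, h⟩ = q}

namespace Hypermap

variable {X : Type*} (M : Hypermap X) (i j : Fin 3) (S : Set (M.Cell i))

/-! The construction of the partial dual relative to a set `S` of cells of type `i`, with an
auxiliary type `j ≠ i`. All surfaces that occur are glued from disks along arcs of `M`. -/

/-- The disks that form the surface `F`: the cells in `S` and all the cells of type `j`. -/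
def stepOneDisks : Set (Σ t, M.Cell t) :=
  {d | d.1 = j ∨ ∃ s ∈ S, d = ⟨i, s⟩}

/-- The boundary `∂F`. -/
def stepOneBoundary : Set M.Arc :=
  boundaryArcs fun d : M.stepOneDisks i j S => M.circle d.1

/-- The cells of type `j` of the partial dual: a disk glued to each component of `∂F`. -/
def NewCellJ : Type _ := Component Arc.ends (M.stepOneBoundary i j S)

/-- The boundary circles of the disks of the surface made of a copy of every cell of type `i` and
of the new cells of type `j`. The former are attached to the latter along those arcs of their
boundary circles that lie on `∂F`. -/
def stepThreeCircle : M.Cell i ⊕ M.NewCellJ i j S → Set M.Arc :=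
  Sum.elim (fun v => M.circle ⟨i, v⟩) Component.arcs

/-- The boundary of that surface. -/
def stepThreeBoundary : Set M.Arc :=
  boundaryArcs (M.stepThreeCircle i j S)

/-- The cells of the third type: a disk glued to each component of the boundary of the surface
made of the other cells. -/
def NewCellK : Type _ := Component Arc.ends (M.stepThreeBoundary i j S)

/-- The boundary circles of the cells of type `t` of the partial dual. -/
def dualCircles (t : Fin 3) : Set (Set M.Arc) :=
  if t = i then Set.range fun v : M.Cell i => M.circle ⟨i, v⟩
  else if t = j then Set.range (Component.arcs : M.NewCellJ i j S → Set M.Arc)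
  else Set.range (Component.arcs : M.NewCellK i j S → Set M.Arc)

/-- The arcs of colour `c` of the partial dual: those along which two of its cells, of the two
types different from `c`, meet. -/
def dualArcs (c : Fin 3) : Set M.Arc :=
  {a | ∀ t, t ≠ c → ∃ C ∈ M.dualCircles i j S t, a ∈ C}

end Hypermap

/-- An oriented hypermap. The flags are divided into positive (`x ∈ pos`) and negative ones so that
the two ends of every arc have opposite signs. Equivalently the boundary circles of all cells are
directed, coherently with an orientation of the surface: the circle of a cell of type `t` runs
along the arcs of colour `t + 1` from the positive to the negative end, and along the arcs of
colour `t + 2` from the negative to the positive end. -/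
@[ext]
structure OrientedHypermap (X : Type*) extends Hypermap X where
  pos : Set X
  pos_τ : ∀ c x, τ c x ∈ pos ↔ x ∉ pos

namespace OrientedHypermap

variable {X : Type*} (M : OrientedHypermap X)

/-- The directed boundary circle of the cell of type `t` at `x` leaves `x` along the arc of colour
`c` (where `c ≠ t`). -/
def Leaves (t c : Fin 3) (x : X) : Prop := x ∈ M.pos ↔ c = t + 1

/-- `D` is the partial dual of `M` relative to the set `S` of cells of type `i`, constructed with
the auxiliary type `j`. -/
structure IsPartialDual (i j : Fin 3) (S : Set (M.Cell i)) (D : OrientedHypermap X) : Prop where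
  /-- The cells of `D` are the disks of the construction. -/
  cells : ∀ t x y, D.cell t x = D.cell t y ↔
    ∃ C ∈ M.dualCircles i j S t, (∃ a ∈ C, x ∈ a.ends) ∧ ∃ a ∈ C, y ∈ a.ends
  /-- The arcs of `D` are the arcs along which these disks meet. -/
  arcs : ∀ c x y, D.τ c x = y ↔ ∃ a ∈ M.dualArcs i j S c, a.ends = s(x, y)
  /-- The surface `F` is oriented as a part of the surface of `M`. The boundary circles of the new
  cells of type `j` have the direction of `∂F`, that is, they run along each arc of `∂F` in the
  same direction as the boundary circle of the disk `d` of `F` on which this arc lies. -/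
  orientation : ∀ a ∈ M.stepOneBoundary i j S, ∀ d ∈ M.stepOneDisks i j S, a ∈ M.circle d →
    ∀ c, c ≠ j → a ∈ M.dualArcs i j S c → ∀ x ∈ a.ends,
      (D.Leaves j c x ↔ M.Leaves d.1 a.colour x)

/-- The permutations `σV`, `σE`, `σF` of `H` are the `σ`-model of `M`, where `ℓ` labels the
half-edges, i.e. the arcs of intersection of vertices with hyperedges, each represented by its
positive end, by the elements of `H`. -/
structure IsSigmaModel {H : Type*} (ℓ : H → X) (σV σE σF : Equiv.Perm H) : Prop where
  injective : Function.Injective ℓ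
  range_eq : Set.range ℓ = M.pos
  vertex : ∀ h, ℓ (σV h) = M.τ 2 (M.τ 1 (ℓ h))
  hyperedge : ∀ h, ℓ (σE h) = M.τ 0 (M.τ 2 (ℓ h))
  face : ∀ h, ℓ (σF h) = M.τ 1 (M.τ 0 (ℓ h))
  mul_eq_one : σF * σE * σV = 1

end OrientedHypermap

/-- The cycles of a permutation, including the cycles of length one. -/
abbrev PermCycle {H : Type*} (σ : Equiv.Perm H) : Type _ :=
  Quotient (Equiv.Perm.SameCycle.setoid σ)

open Classical in
/-- The permutation consisting of those cycles of `σ` that belong to `C`: it agrees with `σ` on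
the elements of these cycles and fixes all other elements. -/
noncomputable def cyclePart {H : Type*} (σ : Equiv.Perm H) (C : Set (PermCycle σ)) :
    Equiv.Perm H :=
  Equiv.Perm.ofSubtype (p := fun h => (Quotient.mk _ h : PermCycle σ) ∈ C)
    (σ.subtypePerm fun h => by
      have e : (Quotient.mk _ (σ h) : PermCycle σ) = Quotient.mk _ h :=
        Quotient.sound (Equiv.Perm.sameCycle_apply_left.2 (Equiv.Perm.SameCycle.refl σ h))
      rw [e])

/-- The cycles of `σ` corresponding to the elements of a set `S` of cells of type `t`, for a
labelling `ℓ` of half-edges by positive flags. -/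
def cyclesOf {X H : Type*} (M : Hypermap X) (ℓ : H → X) (σ : Equiv.Perm H) {t : Fin 3}
    (S : Set (M.Cell t)) : Set (PermCycle σ) :=
  {q | ∃ h, M.cell t (ℓ h) ∈ S ∧ q = Quotient.mk _ h}

/-!
The partial dual keeps the flags and merely permutes the colours of arcs: along the boundary of a
cell of type `i` that belongs to `S`, the colours `i + 1` and `i + 2` are exchanged, and every other
arc keeps its colour (`Hypermap.twist`, `Hypermap.partialDual`). The auxiliary type `j` does not
enter this description.

To see that the construction yields this hypermap, one decides for each arc on which disks it lies.
An arc lies on `∂F` if and only if its new colour is not `j`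
(`Hypermap.arc_twist_mem_stepOneBoundary`), and on the boundary of the second surface if and only if
its new colour is not the third type (`Hypermap.arc_twist_mem_stepThreeBoundary`). The components of
such a set of arcs are the circles of the cells of the recoloured hypermap, since these cells are
the orbits of the two remaining involutions (`Hypermap.range_arcs_eq`). Hence the disks of the
construction are the cells of the recoloured hypermap (`Hypermap.dualCircles_eq`), and the signs of
the flags are unchanged because an arc of colour `i` at a flag lies on `∂F` and on a disk of
type `j` both before and after.

The formulas for the permutations follow by comparing compositions of two recoloured involutions
with the original ones. With `ρ t = τ (t + 2) τ (t + 1)`, the twist at `S` inverts `ρ i` on the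
cycles in `S`, and `ρ (i + 1)`, `ρ (i + 2)` are multiplied by these cycles on the right and on
the left. This treats all three types uniformly.
-/

theorem ne_add_one_fin_three : ∀ i : Fin 3, i ≠ i + 1 := by decide

theorem ne_add_two_fin_three : ∀ i : Fin 3, i ≠ i + 2 := by decide

theorem eq_of_ne_fin_three :
    ∀ i j k c : Fin 3, j ≠ i → k ≠ i → k ≠ j → c ≠ k → c ≠ i → c = j := by decide

/-- At a cell in `S`, the disks of `F` that contain an arc of new colour `c` are those of type `i`
or `j` different from the old colour. There is just one unless the old colour is the third type,
that is, unless `c = j`. -/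
theorem existsUnique_swap_fin_three : ∀ i j c : Fin 3, j ≠ i →
    ((∃! t, t ≠ Equiv.swap (i + 1) (i + 2) c ∧ (t = j ∨ t = i)) ↔ c ≠ j) := by
  unfold ExistsUnique; decide

/-- At a cell in `S`, the circle of a disk of type `t` of `F` and that of the new disk of type `j`
run in the same direction along their common arc of new colour `c`. -/
theorem eq_add_one_iff_swap_fin_three : ∀ i j c t : Fin 3, j ≠ i → c ≠ j → t = j ∨ t = i →
    Equiv.swap (i + 1) (i + 2) c ≠ t →
      (c = j + 1 ↔ Equiv.swap (i + 1) (i + 2) c = t + 1) := by decide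

namespace Hypermap

variable {X : Type*} (M : Hypermap X)

/-! ### Arcs and cells -/

theorem cell_τ {t c : Fin 3} (h : c ≠ t) (x : X) : M.cell t (M.τ c x) = M.cell t x :=
  Quotient.sound ⟨⟨M.τ c, Subgroup.subset_closure ⟨c, h, rfl⟩⟩, rfl⟩

/-- A function invariant under the involutions generating the group of a cell is constant on
the cell. -/
theorem eq_of_cell_eq {α : Sort*} {t : Fin 3} (f : X → α) (hf : ∀ c, c ≠ t → ∀ x, f (M.τ c x) = f x)
    {x y : X} (h : M.cell t x = M.cell t y) : f x = f y := by
  obtain ⟨⟨g, hg⟩, rfl⟩ := Quotient.exact h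
  change f (g y) = f y
  clear h
  induction hg using Subgroup.closure_induction generalizing y with
  | mem g hg => obtain ⟨c, hc, rfl⟩ := hg; exact hf c hc y
  | one => rfl
  | mul a b _ _ iha ihb => exact iha.trans ihb
  | inv a _ iha => simpa using (iha (y := a⁻¹ y)).symm

/-- The arc of colour `c` at the flag `x`. -/
def arc (c : Fin 3) (x : X) : M.Arc := ⟨c, s(x, M.τ c x), x, rfl⟩

theorem arc_τ (c : Fin 3) (x : X) : M.arc c (M.τ c x) = M.arc c x := by
  simp [arc, M.τ_invol, Sym2.eq_swap]

theorem mem_ends_arc {c : Fin 3} {x y : X} : y ∈ (M.arc c x).ends ↔ y = x ∨ y = M.τ c x :=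
  Sym2.mem_iff

theorem Arc.eq_arc {M : Hypermap X} {a : M.Arc} {x : X} (h : x ∈ a.ends) :
    a = M.arc a.colour x := by
  obtain ⟨c, e, z, rfl⟩ := a
  rcases Sym2.mem_iff.1 h with rfl | rfl
  · rfl
  · exact (M.arc_τ c z).symm

theorem arc_mem_circle {c : Fin 3} {x : X} {d : Σ t, M.Cell t} :
    M.arc c x ∈ M.circle d ↔ c ≠ d.1 ∧ M.cell d.1 x = d.2 := by
  refine and_congr_right fun (h : c ≠ d.1) => ⟨?_, fun h' => ⟨x, by simp [mem_ends_arc], h'⟩⟩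
  rintro ⟨y, hy, h'⟩
  rcases M.mem_ends_arc.1 hy with rfl | rfl
  · exact h'
  · rwa [M.cell_τ h] at h'

/-! ### The recoloured hypermap -/

variable (i : Fin 3) (S : Set (M.Cell i))

open Classical in
/-- The arc of colour `c` at the flag `x` of the partial dual is the arc of colour `twist x c` of
the original hypermap: the two colours on the circle of the cell of type `i` at `x` are exchanged if
this cell belongs to `S`. -/
noncomputable def twist (x : X) : Equiv.Perm (Fin 3) :=
  if M.cell i x ∈ S then Equiv.swap (i + 1) (i + 2) else 1

theorem twist_of_mem {x : X} (h : M.cell i x ∈ S) :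
    M.twist i S x = Equiv.swap (i + 1) (i + 2) := if_pos h

theorem twist_of_notMem {x : X} (h : M.cell i x ∉ S) : M.twist i S x = 1 := if_neg h

@[simp]
theorem twist_twist (x : X) (c : Fin 3) : M.twist i S x (M.twist i S x c) = c := by
  unfold twist; split_ifs <;> simp

@[simp]
theorem twist_self (x : X) : M.twist i S x i = i := by
  unfold twist
  split_ifs
  · exact Equiv.swap_apply_of_ne_of_ne (ne_add_one_fin_three i) (ne_add_two_fin_three i)
  · rfl

theorem twist_eq_self_iff {x : X} {c : Fin 3} : M.twist i S x c = i ↔ c = i := by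
  constructor
  · intro h; rw [← M.twist_twist i S x c, h, twist_self]
  · rintro rfl; simp

theorem twist_τ (x : X) (c : Fin 3) :
    M.twist i S (M.τ (M.twist i S x c) x) c = M.twist i S x c := by
  by_cases hc : c = i
  · subst hc; simp
  · have h := M.cell_τ (show M.twist i S x c ≠ i by rwa [Ne, twist_eq_self_iff]) x
    generalize M.τ (M.twist i S x c) x = y at h
    rw [twist, h, twist]

/-- The hypermap whose arcs are recoloured by `twist`. -/
noncomputable def partialDual : Hypermap X where
  τ c := Function.Involutive.toPerm (fun x => M.τ (M.twist i S x c) x) fun x => by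
    beta_reduce
    rw [twist_τ, M.τ_invol]
  τ_invol c x := Function.Involutive.toPerm_involutive _ x
  τ_ne c x := M.τ_ne _ x

theorem partialDual_τ (c : Fin 3) (x : X) :
    (M.partialDual i S).τ c x = M.τ (M.twist i S x c) x := rfl

theorem arc_twist_τ (c : Fin 3) (x : X) :
    M.arc (M.twist i S ((M.partialDual i S).τ c x) c) ((M.partialDual i S).τ c x) =
      M.arc (M.twist i S x c) x := by
  rw [partialDual_τ, twist_τ, arc_τ]

theorem Arc.eq_arc_twist {M : Hypermap X} {i : Fin 3} (S : Set (M.Cell i)) {a : M.Arc} {x : X}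
    (h : x ∈ a.ends) : ∃ c, a = M.arc (M.twist i S x c) x :=
  ⟨M.twist i S x a.colour, by rw [twist_twist, ← Arc.eq_arc h]⟩

theorem Arc.exists_eq_arc_twist {M : Hypermap X} {i : Fin 3} (S : Set (M.Cell i)) (a : M.Arc) :
    ∃ c x, a = M.arc (M.twist i S x c) x := by
  obtain ⟨x, hx⟩ := a.isArc
  obtain ⟨c, h⟩ := Arc.eq_arc_twist S (a := a) (x := x) (by simp [hx])
  exact ⟨c, x, h⟩

theorem partialDual_cell_self_eq_iff {x y : X} :
    (M.partialDual i S).cell i x = (M.partialDual i S).cell i y ↔ M.cell i x = M.cell i y := by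
  constructor
  · refine eq_of_cell_eq _ (M.cell i) fun c hc x => ?_
    exact M.cell_τ (by rwa [Ne, twist_eq_self_iff]) x
  · refine eq_of_cell_eq _ _ fun c hc x => ?_
    have h := (M.partialDual i S).cell_τ (t := i) (c := M.twist i S x c)
      (by rwa [Ne, twist_eq_self_iff]) x
    rwa [partialDual_τ, twist_twist] at h

/-- The circle of the cell of type `t` at `x` of the recoloured hypermap, as a set of arcs of the
original one. -/
def dualCircle (t : Fin 3) (x : X) : Set M.Arc :=
  {a | ∃ c y, c ≠ t ∧ a = M.arc (M.twist i S y c) y ∧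
    (M.partialDual i S).cell t y = (M.partialDual i S).cell t x}

theorem arc_twist_mem_dualCircle {t c : Fin 3} {x y : X} :
    M.arc (M.twist i S y c) y ∈ M.dualCircle i S t x ↔
      c ≠ t ∧ (M.partialDual i S).cell t y = (M.partialDual i S).cell t x := by
  refine ⟨?_, fun h => ⟨c, y, h.1, rfl, h.2⟩⟩
  rintro ⟨c', z, hc, e, h⟩
  have hy : y ∈ (M.arc (M.twist i S z c') z).ends := by rw [← e]; simp [mem_ends_arc]
  have hcol : M.twist i S y c = M.twist i S z c' := congrArg Arc.colour e
  rcases M.mem_ends_arc.1 hy with rfl | hy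
  · rw [(M.twist i S y).injective hcol]; exact ⟨hc, h⟩
  · rw [← M.twist_τ i S z c', ← hy] at hcol
    rw [(M.twist i S y).injective hcol, hy, ← h]
    exact ⟨hc, cell_τ _ hc z⟩

/-! ### The disks of the construction -/

/-- A set of arcs that omits exactly the new colour `t` at every flag is the union of the circles
of the cells of type `t` of the recoloured hypermap, and these circles are its components. -/
theorem range_arcs_eq {t : Fin 3} {B : Set M.Arc}
    (hB : ∀ c x, M.arc (M.twist i S x c) x ∈ B ↔ c ≠ t) :
    Set.range (Component.arcs : Component Arc.ends B → Set M.Arc) =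
      Set.range (M.dualCircle i S t) := by
  -- The component of an arc of `B` is the component of any other arc of `B` at the same flag.
  have key : ∀ c x (h : M.arc (M.twist i S x c) x ∈ B),
      Component.arcs (Quot.mk _ ⟨_, h⟩ : Component Arc.ends B) = M.dualCircle i S t x := by
    intro c x h
    ext b
    constructor
    · rintro ⟨hb, e⟩
      -- Membership in the circle at `x` is invariant under the relation generating components.
      let P : Component Arc.ends B → Prop := Quot.lift (fun a => a.1 ∈ M.dualCircle i S t x) (by
        rintro ⟨a, ha⟩ ⟨b, hb⟩ ⟨z, hza, hzb⟩
        obtain ⟨c₁, rfl⟩ := Arc.eq_arc_twist S hza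
        obtain ⟨c₂, rfl⟩ := Arc.eq_arc_twist S hzb
        rw [hB] at ha hb
        simp [arc_twist_mem_dualCircle, ha, hb])
      have hP : P (Quot.mk _ ⟨_, h⟩) :=
        (M.arc_twist_mem_dualCircle i S).2 ⟨(hB _ _).1 h, rfl⟩
      rw [← e] at hP
      exact hP
    · rintro ⟨c', y, hc', rfl, hy⟩
      refine ⟨(hB _ _).2 hc', ?_⟩
      -- The component at a flag is invariant under the involutions of colours different from `t`.
      have hmk : ∀ c₁ c₂ z (h₁ : c₁ ≠ t) (h₂ : c₂ ≠ t),
          (Quot.mk _ ⟨_, (hB c₁ z).2 h₁⟩ : Component Arc.ends B) = Quot.mk _ ⟨_, (hB c₂ z).2 h₂⟩ :=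
        fun c₁ c₂ z h₁ h₂ => Quot.sound ⟨z, by simp [mem_ends_arc], by simp [mem_ends_arc]⟩
      have hne : c ≠ t := (hB _ _).1 h
      have := (M.partialDual i S).eq_of_cell_eq (t := t)
        (fun z => (Quot.mk _ ⟨_, (hB c z).2 hne⟩ : Component Arc.ends B)) (fun c₁ h₁ z => by
          refine (hmk c c₁ _ hne h₁).trans (Eq.trans ?_ (hmk c₁ c z h₁ hne))
          congr 1
          exact Subtype.ext (M.arc_twist_τ i S c₁ z)) hy
      exact (hmk c' c y hc' hne).trans this
  ext C
  constructor
  · rintro ⟨q, rfl⟩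
    induction q using Quot.ind with
    | mk a =>
      obtain ⟨a, ha⟩ := a
      obtain ⟨c, x, rfl⟩ := Arc.exists_eq_arc_twist S a
      exact ⟨x, (key c x ha).symm⟩
  · rintro ⟨x, rfl⟩
    exact ⟨_, key (t + 1) x ((hB _ _).2 (ne_add_one_fin_three t).symm)⟩

variable {i} {j : Fin 3}

theorem mk_cell_mem_stepOneDisks {t : Fin 3} {x : X} :
    (⟨t, M.cell t x⟩ : Σ t, M.Cell t) ∈ M.stepOneDisks i j S ↔
      t = j ∨ t = i ∧ M.cell i x ∈ S := by
  refine or_congr_right ⟨?_, ?_⟩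
  · rintro ⟨s, hs, e⟩
    obtain ⟨rfl, e⟩ := Sigma.mk.inj_iff.1 e
    rw [eq_of_heq e]
    exact ⟨rfl, hs⟩
  · rintro ⟨rfl, h⟩
    exact ⟨_, h, rfl⟩

theorem arc_mem_stepOneBoundary {c : Fin 3} {x : X} :
    M.arc c x ∈ M.stepOneBoundary i j S ↔
      ∃! t, t ≠ c ∧ (t = j ∨ t = i ∧ M.cell i x ∈ S) := by
  constructor
  · rintro ⟨⟨⟨t, q⟩, hq⟩, h, hu⟩
    obtain ⟨hc, e⟩ := M.arc_mem_circle.1 h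
    dsimp only at hc e
    subst e
    refine ⟨t, ⟨hc.symm, (M.mk_cell_mem_stepOneDisks S).1 hq⟩, fun t' ht' => ?_⟩
    have := hu ⟨⟨t', M.cell t' x⟩, (M.mk_cell_mem_stepOneDisks S).2 ht'.2⟩ (M.arc_mem_circle.2 ⟨ht'.1.symm, rfl⟩)
    exact congrArg (fun d => d.1.1) this
  · rintro ⟨t, ⟨hc, ht⟩, hu⟩
    refine ⟨⟨⟨t, M.cell t x⟩, (M.mk_cell_mem_stepOneDisks S).2 ht⟩, M.arc_mem_circle.2 ⟨hc.symm, rfl⟩, ?_⟩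
    rintro ⟨⟨t', q⟩, hq⟩ h
    obtain ⟨hc', e⟩ := M.arc_mem_circle.1 h
    dsimp only at hc' e
    subst e
    obtain rfl := hu t' ⟨hc'.symm, (M.mk_cell_mem_stepOneDisks S).1 hq⟩
    rfl

/-- The boundary `∂F` consists of the arcs whose new colour is not `j`. -/
theorem arc_twist_mem_stepOneBoundary (hij : j ≠ i) (c : Fin 3) (x : X) :
    M.arc (M.twist i S x c) x ∈ M.stepOneBoundary i j S ↔ c ≠ j := by
  rw [arc_mem_stepOneBoundary]
  by_cases h : M.cell i x ∈ S
  · rw [twist_of_mem _ _ _ h]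
    simp only [h, and_true]
    exact existsUnique_swap_fin_three i j c hij
  · rw [twist_of_notMem _ _ _ h]
    simp only [h, and_false, or_false, Equiv.Perm.one_apply]
    exact ⟨fun ⟨t, ⟨h₁, h₂⟩, _⟩ => h₂ ▸ h₁.symm, fun h => ⟨j, ⟨h.symm, rfl⟩, fun t ht => ht.2⟩⟩

theorem arc_twist_mem_stepThreeBoundary (hij : j ≠ i) {k : Fin 3} (hki : k ≠ i) (hkj : k ≠ j)
    (c : Fin 3) (x : X) :
    M.arc (M.twist i S x c) x ∈ M.stepThreeBoundary i j S ↔ c ≠ k := by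
  -- The arc lies on one cell of type `i` if `c ≠ i`, and on one new cell of type `j` if `c ≠ j`.
  have hl : ∀ v : M.Cell i, M.arc (M.twist i S x c) x ∈ M.stepThreeCircle i j S (.inl v) ↔
      c ≠ i ∧ M.cell i x = v := fun v => by
    rw [← (M.twist_eq_self_iff i S (x := x) (c := c)).ne]
    exact M.arc_mem_circle
  have hr : ∀ q : M.NewCellJ i j S, M.arc (M.twist i S x c) x ∈ M.stepThreeCircle i j S (.inr q) ↔
      ∃ h : c ≠ j, Quot.mk _ ⟨_, (M.arc_twist_mem_stepOneBoundary S hij c x).2 h⟩ = q := fun q =>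
    ⟨fun ⟨h, e⟩ => ⟨(M.arc_twist_mem_stepOneBoundary S hij c x).1 h, e⟩, fun ⟨_, e⟩ => ⟨_, e⟩⟩
  constructor
  · rintro ⟨d, -, hu⟩ rfl
    have h₁ := hu _ ((hl _).2 ⟨hki, rfl⟩)
    have h₂ := hu _ ((hr _).2 ⟨hkj, rfl⟩)
    exact Sum.inl_ne_inr (h₁.trans h₂.symm)
  · intro hk
    by_cases hc : c = i
    · subst hc
      refine ⟨_, (hr _).2 ⟨hij.symm, rfl⟩, ?_⟩
      rintro (v | q) h
      · exact absurd rfl ((hl v).1 h).1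
      · obtain ⟨_, rfl⟩ := (hr q).1 h; rfl
    · have hcj : c = j := eq_of_ne_fin_three i j k c hij hki hkj hk hc
      refine ⟨_, (hl _).2 ⟨hc, rfl⟩, ?_⟩
      rintro (v | q) h
      · rw [((hl v).1 h).2]
      · exact absurd hcj ((hr q).1 h).1

/-- The disks of the construction are bounded by the circles of the cells of the recoloured
hypermap. -/
theorem dualCircles_eq (hij : j ≠ i) (t : Fin 3) :
    M.dualCircles i j S t = Set.range (M.dualCircle i S t) := by
  unfold dualCircles
  split_ifs with h₁ h₂
  · subst h₁
    have : ∀ x, M.dualCircle t S t x = M.circle ⟨t, M.cell t x⟩ := by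
      intro x
      ext a
      obtain ⟨c, y, rfl⟩ := Arc.exists_eq_arc_twist S a
      rw [arc_twist_mem_dualCircle, partialDual_cell_self_eq_iff, arc_mem_circle, Ne, Ne,
        twist_eq_self_iff]
    ext C
    constructor
    · rintro ⟨v, rfl⟩
      induction v using Quotient.ind with
      | _ x => exact ⟨x, this x⟩
    · rintro ⟨x, rfl⟩
      exact ⟨_, (this x).symm⟩
  · subst h₂
    exact M.range_arcs_eq i S (M.arc_twist_mem_stepOneBoundary S hij)
  · exact M.range_arcs_eq i S (M.arc_twist_mem_stepThreeBoundary S hij h₁ h₂)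

theorem arc_twist_mem_dualArcs (hij : j ≠ i) {c c' : Fin 3} {x : X} :
    M.arc (M.twist i S x c) x ∈ M.dualArcs i j S c' ↔ c = c' := by
  simp only [dualArcs, Set.mem_ofPred_eq, M.dualCircles_eq S hij, Set.exists_range_iff,
    arc_twist_mem_dualCircle]
  constructor
  · intro h
    by_contra hc
    obtain ⟨_, h, -⟩ := h c hc
    exact h rfl
  · rintro rfl t ht
    exact ⟨x, ht.symm, rfl⟩

end Hypermap

namespace OrientedHypermap

variable {X : Type*} (M : OrientedHypermap X)

/-! ### Existence and uniqueness of the partial dual -/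

/-- The recoloured hypermap with the same positive flags. -/
noncomputable def partialDual (i : Fin 3) (S : Set (M.Cell i)) : OrientedHypermap X where
  toHypermap := M.toHypermap.partialDual i S
  pos := M.pos
  pos_τ _ x := M.pos_τ _ x

theorem isPartialDual_partialDual {i j : Fin 3} (hij : j ≠ i) (S : Set (M.Cell i)) :
    M.IsPartialDual i j S (M.partialDual i S) where
  cells t x y := by
    change (M.toHypermap.partialDual i S).cell t x = (M.toHypermap.partialDual i S).cell t y ↔ _
    rw [M.dualCircles_eq S hij, Set.exists_range_iff]
    have key : ∀ x z, (∃ a ∈ M.dualCircle i S t z, x ∈ a.ends) ↔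
        (M.toHypermap.partialDual i S).cell t x = (M.toHypermap.partialDual i S).cell t z := by
      intro x z
      constructor
      · rintro ⟨a, ha, hx⟩
        obtain ⟨c, rfl⟩ := Hypermap.Arc.eq_arc_twist S hx
        exact ((M.arc_twist_mem_dualCircle i S).1 ha).2
      · intro h
        exact ⟨_, (M.arc_twist_mem_dualCircle i S).2 ⟨(ne_add_one_fin_three t).symm, h⟩,
          by simp [Hypermap.mem_ends_arc]⟩
    simp only [key]
    exact ⟨fun h => ⟨y, h, rfl⟩, fun ⟨z, h₁, h₂⟩ => h₁.trans h₂.symm⟩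
  arcs c x y := by
    constructor
    · rintro rfl
      exact ⟨_, (M.arc_twist_mem_dualArcs S hij (x := x)).2 rfl, rfl⟩
    · rintro ⟨a, ha, e⟩
      obtain ⟨c', rfl⟩ := Hypermap.Arc.eq_arc_twist S (a := a) (x := x) (by simp [e])
      obtain rfl := (M.arc_twist_mem_dualArcs S hij).1 ha
      exact Sym2.congr_right.1 e
  orientation a ha d hd had c hc hac x hx := by
    obtain ⟨c', rfl⟩ := Hypermap.Arc.eq_arc_twist S hx
    obtain rfl := (M.arc_twist_mem_dualArcs S hij).1 hac
    obtain ⟨t, q⟩ := d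
    obtain ⟨hct, e⟩ := M.arc_mem_circle.1 had
    dsimp only at hct e
    subst e
    change (x ∈ M.pos ↔ c' = j + 1) ↔ (x ∈ M.pos ↔ M.twist i S x c' = t + 1)
    suffices c' = j + 1 ↔ M.twist i S x c' = t + 1 by rw [this]
    have ht := (M.mk_cell_mem_stepOneDisks S).1 hd
    by_cases h : M.cell i x ∈ S
    · rw [M.twist_of_mem i S h] at hct ⊢
      exact eq_add_one_iff_swap_fin_three i j c' t hij hc (ht.imp_right And.left) hct
    · rw [M.twist_of_notMem i S h]
      simp only [h, and_false, or_false] at ht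
      rw [ht]; rfl

theorem IsPartialDual.eq_partialDual {M : OrientedHypermap X} {i j : Fin 3} (hij : j ≠ i)
    {S : Set (M.Cell i)} {D : OrientedHypermap X} (hD : M.IsPartialDual i j S D) :
    D = M.partialDual i S := by
  refine OrientedHypermap.ext ?_ ?_
  · funext c
    ext x
    rw [hD.arcs, ← (M.isPartialDual_partialDual hij S).arcs]
  · ext x
    -- The arc of colour `i` at `x` lies on `∂F`, keeps its colour and lies on a cell of type `j`.
    have h := hD.orientation (M.arc (M.twist i S x i) x)
      ((M.arc_twist_mem_stepOneBoundary S hij i x).2 hij.symm) ⟨j, M.cell j x⟩ (.inl rfl)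
      (M.arc_mem_circle.2 ⟨by simpa using hij.symm, rfl⟩) i hij.symm
      ((M.arc_twist_mem_dualArcs S hij).2 rfl) x (by simp [Hypermap.mem_ends_arc])
    change (x ∈ D.pos ↔ i = j + 1) ↔ (x ∈ M.pos ↔ M.twist i S x i = j + 1) at h
    rw [Hypermap.twist_self] at h
    change x ∈ D.pos ↔ x ∈ M.pos
    tauto

theorem existsUnique_isPartialDual {i j : Fin 3} (hij : j ≠ i) (S : Set (M.Cell i)) :
    ∃! D, M.IsPartialDual i j S D :=
  ⟨_, M.isPartialDual_partialDual hij S, fun _ h => h.eq_partialDual hij⟩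

end OrientedHypermap

/-! ### Parts of permutations -/

section CyclePart

variable {H : Type*} (σ : Equiv.Perm H) (C : Set (PermCycle σ))

theorem cyclePart_apply_of_mem {h : H} (hh : (Quotient.mk _ h : PermCycle σ) ∈ C) :
    cyclePart σ C h = σ h := by
  classical
  exact Equiv.Perm.ofSubtype_apply_of_mem (p := fun h => (Quotient.mk _ h : PermCycle σ) ∈ C) _ hh

theorem cyclePart_apply_of_notMem {h : H} (hh : (Quotient.mk _ h : PermCycle σ) ∉ C) :
    cyclePart σ C h = h := by
  classical
  exact Equiv.Perm.ofSubtype_apply_of_not_mem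
    (p := fun h => (Quotient.mk _ h : PermCycle σ) ∈ C) _ hh

variable {X : Type*} {M : Hypermap X} {ℓ : H → X} {i : Fin 3}

variable (M ℓ i) in
/-- The permutation `σ` of the half-edges is the rotation `τ (i + 2) τ (i + 1)` around the cells of
type `i`. -/
def IsRotation : Prop := ∀ h, ℓ (σ h) = M.τ (i + 2) (M.τ (i + 1) (ℓ h))

variable {σ}

theorem IsRotation.cell_apply (hσ : IsRotation σ M ℓ i) (h : H) :
    M.cell i (ℓ (σ h)) = M.cell i (ℓ h) := by
  rw [hσ, M.cell_τ ((ne_add_two_fin_three i).symm), M.cell_τ ((ne_add_one_fin_three i).symm)]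

theorem IsRotation.apply_inv (hσ : IsRotation σ M ℓ i) (h : H) :
    ℓ (σ⁻¹ h) = M.τ (i + 1) (M.τ (i + 2) (ℓ h)) := by
  have := hσ (σ⁻¹ h)
  rw [show σ (σ⁻¹ h) = h from σ.apply_symm_apply h] at this
  rw [this, M.τ_invol, M.τ_invol]

theorem IsRotation.mk_mem_cyclesOf (hσ : IsRotation σ M ℓ i) {S : Set (M.Cell i)} {h : H} :
    (Quotient.mk _ h : PermCycle σ) ∈ cyclesOf M ℓ σ S ↔ M.cell i (ℓ h) ∈ S := by
  refine ⟨?_, fun hh => ⟨h, hh, rfl⟩⟩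
  rintro ⟨h', hS, e⟩
  obtain ⟨n, rfl⟩ : Equiv.Perm.SameCycle σ h h' := Quotient.exact e
  suffices M.cell i (ℓ ((σ ^ n) h)) = M.cell i (ℓ h) by rwa [this] at hS
  clear hS e
  induction n with
  | zero => rfl
  | succ n ih => rwa [add_comm, zpow_add, zpow_one, Equiv.Perm.mul_apply, hσ.cell_apply]
  | pred n ih =>
    rwa [← hσ.cell_apply, ← Equiv.Perm.mul_apply, ← zpow_one_add, add_sub_cancel]

/-! ### The rotations of the partial dual -/

variable {S : Set (M.Cell i)} {ρ : Equiv.Perm H}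

theorem IsRotation.apply_cyclePart (hσ : IsRotation σ M ℓ i) (h : H) :
    ℓ (cyclePart σ (cyclesOf M ℓ σ S) h) = M.τ (i + 2) (M.τ (M.twist i S (ℓ h) (i + 2)) (ℓ h)) := by
  by_cases hh : M.cell i (ℓ h) ∈ S
  · rw [cyclePart_apply_of_mem _ _ (hσ.mk_mem_cyclesOf.2 hh), hσ, M.twist_of_mem i S hh,
      Equiv.swap_apply_right]
  · rw [cyclePart_apply_of_notMem _ _ (hσ.mk_mem_cyclesOf.not.2 hh), M.twist_of_notMem i S hh,
      Equiv.Perm.one_apply, M.τ_invol]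

theorem IsRotation.cyclePart_compl_mul_inv (hσ : IsRotation σ M ℓ i) :
    IsRotation (cyclePart σ (cyclesOf M ℓ σ S)ᶜ * (cyclePart σ (cyclesOf M ℓ σ S))⁻¹)
      (M.partialDual i S) ℓ i := by
  intro h
  have hcell : M.cell i (M.τ (M.twist i S (ℓ h) (i + 1)) (ℓ h)) = M.cell i (ℓ h) :=
    M.cell_τ (by rw [Ne, M.twist_eq_self_iff]; exact (ne_add_one_fin_three i).symm) _
  rw [Equiv.Perm.mul_apply, Hypermap.partialDual_τ, Hypermap.partialDual_τ]
  by_cases hh : M.cell i (ℓ h) ∈ S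
  · have hinv : M.cell i (ℓ (σ⁻¹ h)) ∈ S := by
      rwa [hσ.apply_inv, M.cell_τ (ne_add_one_fin_three i).symm,
        M.cell_τ (ne_add_two_fin_three i).symm]
    have e : (cyclePart σ (cyclesOf M ℓ σ S))⁻¹ h = σ⁻¹ h := by
      rw [Equiv.Perm.inv_eq_iff_eq, cyclePart_apply_of_mem _ _ (hσ.mk_mem_cyclesOf.2 hinv)]
      exact (σ.apply_symm_apply h).symm
    rw [e, cyclePart_apply_of_notMem _ _ 
        (Set.notMem_compl_iff.2 (hσ.mk_mem_cyclesOf.2 hinv)), hσ.apply_inv,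
      M.twist_of_mem i S (hcell ▸ hh), M.twist_of_mem i S hh, Equiv.swap_apply_left,
      Equiv.swap_apply_right]
  · have hn := hσ.mk_mem_cyclesOf.not.2 hh
    have e : (cyclePart σ (cyclesOf M ℓ σ S))⁻¹ h = h := by
      rw [Equiv.Perm.inv_eq_iff_eq, cyclePart_apply_of_notMem _ _ hn]
    rw [e, cyclePart_apply_of_mem _ _ hn, hσ, M.twist_of_notMem i S (hcell ▸ hh),
      M.twist_of_notMem i S hh]
    rfl

theorem IsRotation.mul_cyclePart (hσ : IsRotation σ M ℓ i) (hρ : IsRotation ρ M ℓ (i + 1)) :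
    IsRotation (ρ * cyclePart σ (cyclesOf M ℓ σ S)) (M.partialDual i S) ℓ (i + 1) := by
  intro h
  have e₁ : i + 1 + 1 = i + 2 := add_assoc i 1 1
  have e₂ : i + 1 + 2 = i := (add_assoc i 1 2).trans (add_zero i)
  rw [Equiv.Perm.mul_apply, hρ, hσ.apply_cyclePart, e₁, e₂, M.τ_invol, Hypermap.partialDual_τ,
    Hypermap.partialDual_τ, M.twist_self]

theorem IsRotation.cyclePart_mul (hσ : IsRotation σ M ℓ i) (hρ : IsRotation ρ M ℓ (i + 2)) :
    IsRotation (cyclePart σ (cyclesOf M ℓ σ S) * ρ) (M.partialDual i S) ℓ (i + 2) := by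
  intro h
  have e₁ : i + 2 + 1 = i := (add_assoc i 2 1).trans (add_zero i)
  have e₂ : i + 2 + 2 = i + 1 := add_assoc i 2 2
  rw [Equiv.Perm.mul_apply, hσ.apply_cyclePart, hρ, e₁, e₂, Hypermap.partialDual_τ,
    Hypermap.partialDual_τ, M.twist_self]
  -- The flags `y = τ i (ℓ h)` and `τ (i + 1) y` lie on the same cell of type `i`.
  have hcell := M.cell_τ ((ne_add_one_fin_three i).symm) (M.τ i (ℓ h))
  by_cases hh : M.cell i (M.τ i (ℓ h)) ∈ S
  · rw [M.twist_of_mem i S (hcell ▸ hh), M.twist_of_mem i S hh, Equiv.swap_apply_left,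
      Equiv.swap_apply_right, M.τ_invol]
  · rw [M.twist_of_notMem i S (hcell ▸ hh), M.twist_of_notMem i S hh, Equiv.Perm.one_apply,
      Equiv.Perm.one_apply, M.τ_invol]

end CyclePart

namespace OrientedHypermap

theorem isSigmaModel_of_isRotation {X H : Type*} {D : OrientedHypermap X} {ℓ : H → X}
    {σV σE σF : Equiv.Perm H} (hinj : Function.Injective ℓ) (hrange : Set.range ℓ = D.pos)
    (hV : IsRotation σV D.toHypermap ℓ 0) (hE : IsRotation σE D.toHypermap ℓ 1)
    (hF : IsRotation σF D.toHypermap ℓ 2) : D.IsSigmaModel ℓ σV σE σF where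
  injective := hinj
  range_eq := hrange
  vertex := hV
  hyperedge := hE
  face := hF
  mul_eq_one := by
    ext h
    apply hinj
    rw [Equiv.Perm.mul_apply, Equiv.Perm.mul_apply, hF, hE, hV]
    change D.τ 1 (D.τ 0 (D.τ 0 (D.τ 2 (D.τ 2 (D.τ 1 (ℓ h)))))) = ℓ h
    simp only [D.τ_invol]

end OrientedHypermap

theorem mainTheorem1 {X H : Type*} [Finite X] (M : OrientedHypermap X) (ℓ : H → X)
    (σV σE σF : Equiv.Perm H) (hM : M.IsSigmaModel ℓ σV σE σF) :
    (∀ (V' : Set (M.Cell 0)) (j : Fin 3), j ≠ 0 →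
      (∃! D, M.IsPartialDual 0 j V' D) ∧
      ∀ (D : OrientedHypermap X), M.IsPartialDual 0 j V' D →
      ∀ A : Set (PermCycle σV), A = cyclesOf M.toHypermap ℓ σV V' →
        D.IsSigmaModel ℓ
          (cyclePart σV Aᶜ * (cyclePart σV A)⁻¹) (σE * cyclePart σV A) (cyclePart σV A * σF)) ∧
    (∀ (E' : Set (M.Cell 1)) (j : Fin 3), j ≠ 1 →
      (∃! D, M.IsPartialDual 1 j E' D) ∧
      ∀ (D : OrientedHypermap X), M.IsPartialDual 1 j E' D →
      ∀ A : Set (PermCycle σE), A = cyclesOf M.toHypermap ℓ σE E' →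
        D.IsSigmaModel ℓ
          (cyclePart σE A * σV) (cyclePart σE Aᶜ * (cyclePart σE A)⁻¹) (σF * cyclePart σE A)) ∧
    (∀ (F' : Set (M.Cell 2)) (j : Fin 3), j ≠ 2 →
      (∃! D, M.IsPartialDual 2 j F' D) ∧
      ∀ (D : OrientedHypermap X), M.IsPartialDual 2 j F' D →
      ∀ A : Set (PermCycle σF), A = cyclesOf M.toHypermap ℓ σF F' →
        D.IsSigmaModel ℓ
          (σV * cyclePart σF A) (cyclePart σF A * σE) (cyclePart σF Aᶜ * (cyclePart σF A)⁻¹)) := by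
  have hV : IsRotation σV M.toHypermap ℓ 0 := hM.vertex
  have hE : IsRotation σE M.toHypermap ℓ 1 := hM.hyperedge
  have hF : IsRotation σF M.toHypermap ℓ 2 := hM.face
  refine ⟨fun S j hj => ⟨M.existsUnique_isPartialDual hj S, ?_⟩,
    fun S j hj => ⟨M.existsUnique_isPartialDual hj S, ?_⟩,
    fun S j hj => ⟨M.existsUnique_isPartialDual hj S, ?_⟩⟩
  all_goals
    rintro D hD A rfl
    obtain rfl := hD.eq_partialDual hj
  · exact OrientedHypermap.isSigmaModel_of_isRotation hM.injective hM.range_eq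
      hV.cyclePart_compl_mul_inv (hV.mul_cyclePart hE) (hV.cyclePart_mul hF)
  · exact OrientedHypermap.isSigmaModel_of_isRotation hM.injective hM.range_eq
      (hE.cyclePart_mul hV) hE.cyclePart_compl_mul_inv (hE.mul_cyclePart hF)
  · exact OrientedHypermap.isSigmaModel_of_isRotation hM.injective hM.range_eq
      (hF.mul_cyclePart hV) (hF.cyclePart_mul hE) hF.cyclePart_compl_mul_inv
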